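/- Let $\mathcal F$ be the Fock space of all entire functions $f$ with $\|f\|^2=\int_{\mathbb C}|f(z)|^2e^{-\pi|z|^2}\,dm(z)<\infty$, where $m$ is planar Lebesgue measure, and let $k_\lambda(z)=e^{\pi\bar\lambda z}$ be its reproducing kernel at $\lambda\in\mathbb C$. A system of vectors in $\mathcal F$ is called complete if its closed linear span is $\mathcal F$, and minimal if no member lies in the closed linear span of the others. An entire function $F$ is called a generating function of a set $\Lambda\subset\mathbb C$ if its zeros are simple and are exactly the points of $\Lambda$, if $\frac{F(z)}{z-\lambda}\in\mathcal F$ for some $\lambda\in\Lambda$, and if $FT\notin\mathcal F$ for every entire function $T\not\equiv 0$. Theorem. Let $\Lambda\subset\mathbb C$ be such that the system $\{k_\lambda\}_{\lambda\in\Lambda}$ is complete and minimal in $\mathcal F$, and let $F$ be a generating function of $\Lambda$. Then $\frac{F(z)}{z-\lambda}\in\mathcal F$ for every $\lambda\in\Lambda$, and the system $\left\{\frac{F(z)}{z-\lambda}\right\}_{\lambda\in\Lambda}$ is complete in $\mathcal F$. -/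

import Mathlib

open MeasureTheory

noncomputable section

/-- Membership of a function `f : ℂ → ℂ` in the Fock space: `f` is entire and
`∫ |f(z)|² e^{-π|z|²} dm(z) < ∞`, where `m` is planar Lebesgue measure. -/
def MemFock (f : ℂ → ℂ) : Prop :=
  Differentiable ℂ f ∧
    Integrable (fun z : ℂ => ‖f z‖ ^ 2 * Real.exp (-Real.pi * ‖z‖ ^ 2)) volume

theorem memFock_zero : MemFock 0 :=
  ⟨differentiable_const 0, by simp⟩

theorem MemFock.add {f g : ℂ → ℂ} (hf : MemFock f) (hg : MemFock g) : MemFock (f + g) := by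
  refine ⟨hf.1.add hg.1, ((hf.2.const_mul 2).add (hg.2.const_mul 2)).mono' ?_ ?_⟩
  · have := (hf.1.add hg.1).continuous
    exact Continuous.aestronglyMeasurable (by fun_prop)
  · refine Filter.Eventually.of_forall fun z => ?_
    have he := (Real.exp_pos (-Real.pi * ‖z‖ ^ 2)).le
    rw [Real.norm_of_nonneg (by positivity)]
    have h1 : ‖(f + g) z‖ ^ 2 ≤ 2 * ‖f z‖ ^ 2 + 2 * ‖g z‖ ^ 2 := by
      have h2 : ‖(f + g) z‖ ≤ ‖f z‖ + ‖g z‖ := norm_add_le _ _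
      nlinarith [norm_nonneg ((f + g) z), sq_nonneg (‖f z‖ - ‖g z‖)]
    have := mul_le_mul_of_nonneg_right h1 he
    simp only [Pi.add_apply] at this ⊢
    linarith

theorem MemFock.smul {f : ℂ → ℂ} (c : ℂ) (hf : MemFock f) : MemFock (c • f) := by
  refine ⟨hf.1.const_smul c, (hf.2.const_mul (‖c‖ ^ 2)).congr ?_⟩
  refine Filter.Eventually.of_forall fun z => ?_
  simp only [Pi.smul_apply, norm_smul, mul_pow, mul_assoc]

/-- The Fock space as a vector space of functions. -/
def fockSubmodule : Submodule ℂ (ℂ → ℂ) where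
  carrier := {f | MemFock f}
  zero_mem' := memFock_zero
  add_mem' := MemFock.add
  smul_mem' := fun c _ hf => MemFock.smul c hf

/-- The Fock space `𝓕`. It is a type of its own, so that it carries the topology of its
`L²` norm below and not the topology of pointwise convergence. -/
def FockSpace : Type := fockSubmodule

namespace FockSpace

instance : AddCommGroup FockSpace := inferInstanceAs (AddCommGroup fockSubmodule)

instance : Module ℂ FockSpace := inferInstanceAs (Module ℂ fockSubmodule)

/-- The entire function underlying an element of the Fock space. -/
def toFun (f : FockSpace) : ℂ → ℂ := f.1

instance : CoeFun FockSpace (fun _ => ℂ → ℂ) := ⟨toFun⟩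

/-- An entire function with finite Fock norm, as an element of the Fock space. -/
def mk (f : ℂ → ℂ) (hf : MemFock f) : FockSpace := ⟨f, hf⟩

@[simp] theorem mk_apply (f : ℂ → ℂ) (hf : MemFock f) (z : ℂ) : mk f hf z = f z := rfl

@[simp] theorem add_apply (f g : FockSpace) (z : ℂ) : (f + g) z = f z + g z := rfl

@[simp] theorem smul_apply (c : ℂ) (f : FockSpace) (z : ℂ) : (c • f) z = c * f z := rfl

@[simp] theorem zero_apply (z : ℂ) : (0 : FockSpace) z = 0 := rfl

theorem memFock (f : FockSpace) : MemFock f := f.2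

@[ext] theorem ext {f g : FockSpace} (h : ∀ z, f z = g z) : f = g :=
  Subtype.ext (funext h)

/-- The inner product `∫ conj (f z) g(z) e^{-π|z|²} dm(z)`, which is linear in the second
variable (Mathlib's convention). -/
instance : Inner ℂ FockSpace where
  inner f g := ∫ z : ℂ, (starRingEnd ℂ) (f z) * g z * (Real.exp (-Real.pi * ‖z‖ ^ 2) : ℂ)

theorem inner_def (f g : FockSpace) : inner ℂ f g =
    ∫ z : ℂ, (starRingEnd ℂ) (f z) * g z * (Real.exp (-Real.pi * ‖z‖ ^ 2) : ℂ) := rfl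

theorem integrable_inner (f g : FockSpace) : Integrable
    (fun z : ℂ => (starRingEnd ℂ) (f z) * g z * (Real.exp (-Real.pi * ‖z‖ ^ 2) : ℂ)) := by
  refine (f.memFock.2.add g.memFock.2).mono' ?_ ?_
  · have h1 := f.memFock.1.continuous
    have h2 := g.memFock.1.continuous
    exact Continuous.aestronglyMeasurable (by fun_prop)
  · refine Filter.Eventually.of_forall fun z => ?_
    have he := (Real.exp_pos (-Real.pi * ‖z‖ ^ 2)).le
    rw [norm_mul, norm_mul, RCLike.norm_conj, Complex.norm_real, Real.norm_of_nonneg he]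
    have h1 : ‖f z‖ * ‖g z‖ ≤ ‖f z‖ ^ 2 + ‖g z‖ ^ 2 := by
      nlinarith [sq_nonneg (‖f z‖ - ‖g z‖), sq_nonneg (‖f z‖), sq_nonneg (‖g z‖)]
    have := mul_le_mul_of_nonneg_right h1 he
    simp only [Pi.add_apply] at this ⊢
    linarith

theorem inner_self (f : FockSpace) : inner ℂ f f =
    ((∫ z : ℂ, ‖f z‖ ^ 2 * Real.exp (-Real.pi * ‖z‖ ^ 2) : ℝ) : ℂ) := by
  rw [inner_def, ← integral_complex_ofReal]
  congr 1
  ext z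
  rw [← Complex.normSq_eq_conj_mul_self, Complex.normSq_eq_norm_sq]
  push_cast
  ring

/-- The laws of an inner product. -/
@[reducible] def innerCore : InnerProductSpace.Core ℂ FockSpace where
  conj_inner_symm f g := by
    rw [inner_def, inner_def, ← integral_conj]
    congr 1
    ext z
    simp only [map_mul, Complex.conj_conj, Complex.conj_ofReal]
    ring
  re_inner_nonneg f := by
    rw [inner_self]
    exact integral_nonneg fun z => by positivity
  add_left f g h := by
    rw [inner_def, inner_def, inner_def,
      ← integral_add (integrable_inner f h) (integrable_inner g h)]
    congr 1
    ext z
    simp only [add_apply, map_add]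
    ring
  smul_left f g c := by
    rw [inner_def, inner_def, ← integral_const_mul]
    congr 1
    ext z
    simp only [smul_apply, map_mul]
    ring
  definite f h := by
    rw [inner_self, Complex.ofReal_eq_zero,
      integral_eq_zero_iff_of_nonneg (fun z => by positivity) f.memFock.2] at h
    have hc := f.memFock.1.continuous
    have h0 := (Continuous.ae_eq_iff_eq volume (by fun_prop) continuous_const).1 h
    ext z
    have hz : ‖f z‖ ^ 2 * Real.exp (-Real.pi * ‖z‖ ^ 2) = 0 := congrFun h0 z
    have he := (Real.exp_pos (-Real.pi * ‖z‖ ^ 2)).ne'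
    simpa [he] using (mul_eq_zero.1 hz).resolve_right he

instance : NormedAddCommGroup FockSpace :=
  @InnerProductSpace.Core.toNormedAddCommGroup ℂ FockSpace _ _ _ innerCore

instance : InnerProductSpace ℂ FockSpace := InnerProductSpace.ofCore innerCore.toCore

end FockSpace

theorem memFock_kernel (w : ℂ) :
    MemFock (fun z => Complex.exp (Real.pi * (starRingEnd ℂ) w * z)) := by
  refine ⟨by fun_prop, ?_⟩
  have h := (GaussianFourier.integrable_cexp_neg_mul_sq_norm_add (V := ℂ) (b := (Real.pi : ℂ))
    (by simpa using Real.pi_pos) (2 * Real.pi : ℂ) w).norm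
  refine h.congr (Filter.Eventually.of_forall fun z => ?_)
  simp only [Complex.norm_exp]
  rw [← Real.exp_nat_mul, ← Real.exp_add]
  congr 1
  simp only [Complex.add_re, Complex.mul_re, Complex.mul_im, Complex.neg_re, Complex.neg_im,
    Complex.ofReal_re, Complex.ofReal_im, Complex.conj_re, Complex.conj_im, Complex.inner,
    ← Complex.ofReal_pow, Complex.re_ofNat, Complex.im_ofNat]
  push_cast
  ring

/-- The reproducing kernel `k_w(z) = e^{π \bar w z}` of the Fock space at the point `w`. -/
def fockKernel (w : ℂ) : FockSpace :=
  FockSpace.mk (fun z => Complex.exp (Real.pi * (starRingEnd ℂ) w * z)) (memFock_kernel w)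

/-- A system of vectors is complete if its closed linear span is the whole space. -/
def IsCompleteSystem {ι E : Type*} [NormedAddCommGroup E] [NormedSpace ℂ E] (v : ι → E) : Prop :=
  (Submodule.span ℂ (Set.range v)).topologicalClosure = ⊤

/-- A system of vectors is minimal if none of its members lies in the closed linear span of
the other members. -/
def IsMinimalSystem {ι E : Type*} [NormedAddCommGroup E] [NormedSpace ℂ E] (v : ι → E) : Prop :=
  ∀ i, v i ∉ (Submodule.span ℂ (v '' {j | j ≠ i})).topologicalClosure

/-- The function `z ↦ F(z) / (z - a)`, with the removable singularity at a zero `a` of `F`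
filled in by its limit `F'(a)`. -/
def divLinear (F : ℂ → ℂ) (a : ℂ) : ℂ → ℂ :=
  Function.update (fun z => F z / (z - a)) a (deriv F a)

/-- `F` is a generating function of `Λ`: an entire function whose zeros are simple and are
exactly the points of `Λ`, such that `F(z) / (z - a)` is in the Fock space for some `a ∈ Λ`, and
such that `F T` is not in the Fock space for any entire `T` that is not identically zero. -/
structure IsGeneratingFunction (Λ : Set ℂ) (F : ℂ → ℂ) : Prop where
  entire : Differentiable ℂ F
  zeros : ∀ z, F z = 0 ↔ z ∈ Λ
  simple : ∀ z ∈ Λ, deriv F z ≠ 0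
  div_mem : ∃ a ∈ Λ, MemFock (divLinear F a)
  mul_not_mem : ∀ T : ℂ → ℂ, Differentiable ℂ T → T ≠ 0 → ¬ MemFock (fun z => F z * T z)

end

/-! It suffices that a function h in the Fock space orthogonal to every F(z)/(z-b), b ∈ Λ, is zero.
Put dμ = conj(h) e^{-π|z|²} dm, fix a ∈ Λ with H = F/(z-a) in the space, and write Cν(w) = ∫
dν(z)/(z-w). The function I(w) = (w-a) ∫ (H(z)-H(w))/(z-w) dμ(z) is entire, and orthogonality makes
it vanish on Λ, so I = FG with G entire (`exists_eq_mul_of_simple_zeros`).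

Splitting the difference quotient gives I = (w-a) C(Hμ) - F Cμ. Both transforms are bounded
(`cauchyTransform_bounded`) and (w-a) Cμ is bounded too, so |I| ≤ A(1+|w|) + B|H| and FG lies in the
Fock space (`MemFock.of_growth`). The generating property forces G = 0, hence F Cμ = (w-a) C(Hμ).

If h ≠ 0, some moment of μ is nonzero, and the first such moment keeps Cμ from decaying faster than
a power (`FockSpace.exists_le_norm_cauchyMoment`). Then F has polynomial growth and lies in the Fock
space, against the generating property with T = 1. -/

noncomputable section

/-! ### Gaussian integrals -/

/-- The weight `e^{-π|z|²}` of the Fock space. -/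
def fockWeight (z : ℂ) : ℝ := Real.exp (-Real.pi * ‖z‖ ^ 2)

theorem fockWeight_pos (z : ℂ) : 0 < fockWeight z := Real.exp_pos _

@[fun_prop]
theorem continuous_fockWeight : Continuous fockWeight := by
  unfold fockWeight
  fun_prop

theorem integrable_exp_neg_mul_norm_sq {b : ℝ} (hb : 0 < b) :
    Integrable (fun z : ℂ => Real.exp (-b * ‖z‖ ^ 2)) := by
  have h := (GaussianFourier.integrable_cexp_neg_mul_sq_norm_add (V := ℂ) (b := (b : ℂ))
    (by simpa using hb) 0 0).norm
  refine h.congr (Filter.Eventually.of_forall fun z => ?_)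
  simp only [Complex.norm_exp]
  congr 1
  simp [← Complex.ofReal_pow]

theorem integrable_fockWeight : Integrable fockWeight :=
  integrable_exp_neg_mul_norm_sq Real.pi_pos

/-- The power is at most n! e^{1+t}, and completing the square absorbs the linear exponent t into
half of the Gaussian. -/
theorem one_add_pow_mul_exp_neg_le (n : ℕ) {b : ℝ} (hb : 0 < b) :
    ∃ K, 0 ≤ K ∧ ∀ t : ℝ, 0 ≤ t →
      (1 + t) ^ n * Real.exp (-b * t ^ 2) ≤ K * Real.exp (-(b / 2) * t ^ 2) := by
  refine ⟨n.factorial * Real.exp (1 + 1 / (2 * b)), by positivity, fun t ht => ?_⟩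
  have h1 : (1 + t) ^ n ≤ n.factorial * Real.exp (1 + t) := by
    have := Real.pow_div_factorial_le_exp (1 + t) (by linarith) n
    rw [div_le_iff₀ (by positivity)] at this
    linarith
  have h2 : 1 + t + -b * t ^ 2 ≤ 1 + 1 / (2 * b) + -(b / 2) * t ^ 2 := by
    have : 0 ≤ (b * t - 1) ^ 2 / (2 * b) := by positivity
    have h3 : (b * t - 1) ^ 2 / (2 * b) = b / 2 * t ^ 2 - t + 1 / (2 * b) := by
      field_simp
      ring
    linarith
  calc (1 + t) ^ n * Real.exp (-b * t ^ 2)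
      ≤ n.factorial * Real.exp (1 + t) * Real.exp (-b * t ^ 2) := by gcongr
    _ = n.factorial * Real.exp (1 + t + -b * t ^ 2) := by rw [mul_assoc, ← Real.exp_add]
    _ ≤ n.factorial * Real.exp (1 + 1 / (2 * b) + -(b / 2) * t ^ 2) := by gcongr
    _ = _ := by rw [Real.exp_add, mul_assoc]

theorem integrable_one_add_norm_pow_mul_exp_neg (n : ℕ) {b : ℝ} (hb : 0 < b) :
    Integrable (fun z : ℂ => (1 + ‖z‖) ^ n * Real.exp (-b * ‖z‖ ^ 2)) := by
  obtain ⟨K, hK, h⟩ := one_add_pow_mul_exp_neg_le n hb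
  refine ((integrable_exp_neg_mul_norm_sq (half_pos hb)).const_mul K).mono' ?_ ?_
  · exact Continuous.aestronglyMeasurable (by fun_prop)
  · refine Filter.Eventually.of_forall fun z => ?_
    rw [Real.norm_of_nonneg (by positivity)]
    exact h _ (norm_nonneg z)

/-! ### Rotation averages, Cauchy transforms and entire functions -/

/-- The mean value property of entire functions with respect to a rotation invariant weight. -/
theorem integral_mul_radial {g : ℂ → ℂ} (hg : Differentiable ℂ g) {φ : ℝ → ℝ} (hφ : Continuous φ)
    (hint : Integrable fun z => g z * φ ‖z‖) :
    ∫ z, g z * φ ‖z‖ = g 0 * ∫ z : ℂ, (φ ‖z‖ : ℂ) := by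
  have hgc := hg.continuous
  -- Rotating by θ leaves the integral over z unchanged, while averaging over θ replaces g by g 0;
  -- Fubini compares the two.
  set f : ℝ → ℂ → ℂ := fun θ z => g (circleMap 0 1 θ * z) * φ ‖z‖ with hf
  have hmp : ∀ θ, MeasurePreserving (fun z : ℂ => circleMap 0 1 θ * z) := fun θ => by
    have := (rotation (Circle.exp θ)).measurePreserving
    convert this using 2 with z
    simp [rotation_apply, circleMap]
  have hemb : ∀ θ, MeasurableEmbedding (fun z : ℂ => circleMap 0 1 θ * z) := fun θ =>
    (Homeomorph.mulLeft₀ (circleMap 0 1 θ) (by simp [circleMap])).measurableEmbedding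
  have hfeq : ∀ θ, f θ = (fun z => g z * φ ‖z‖) ∘ fun z => circleMap 0 1 θ * z := fun θ => by
    ext z
    simp [hf]
  have hfint : ∀ θ, Integrable (f θ) := fun θ => by
    rw [hfeq]
    exact ((hmp θ).integrable_comp_emb (hemb θ)).2 hint
  have hrot : ∀ θ, ∫ z, f θ z = ∫ z, g z * φ ‖z‖ := fun θ => by
    rw [hfeq]
    exact (hmp θ).integral_comp (hemb θ) fun z => g z * (φ ‖z‖ : ℂ)
  have hrotn : ∀ θ, ∫ z, ‖f θ z‖ = ∫ z, ‖g z * φ ‖z‖‖ := fun θ => by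
    rw [hfeq]
    exact (hmp θ).integral_comp (hemb θ) (fun z => ‖g z * φ ‖z‖‖)
  have hprod : Integrable (Function.uncurry f)
      ((volume.restrict (Set.Ioc 0 (2 * Real.pi))).prod volume) := by
    rw [integrable_prod_iff]
    · refine ⟨Filter.Eventually.of_forall hfint, ?_⟩
      simp only [Function.uncurry_apply_pair, hrotn]
      exact integrable_const _
    · refine Continuous.aestronglyMeasurable ?_
      simp only [hf, Function.uncurry_def]
      have := continuous_circleMap 0 1
      fun_prop
  have hswap := integral_integral_swap hprod
  simp only [hrot] at hswap
  have hmean : ∀ z, ∫ θ in Set.Ioc 0 (2 * Real.pi), f θ z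
      = ((2 * Real.pi : ℝ) : ℂ) * (g 0 * φ ‖z‖) := fun z => by
    have h1 : Real.circleAverage (fun ζ => g (ζ * z)) 0 1 = g 0 := by
      have hd : Differentiable ℂ fun ζ => g (ζ * z) := hg.comp (by fun_prop)
      simpa using hd.diffContOnCl.circleAverage (c := (0 : ℂ)) (R := 1)
    rw [Real.circleAverage_def, intervalIntegral.integral_of_le (by positivity)] at h1
    simp only [hf]
    rw [integral_mul_const, ← h1, Complex.real_smul, ← mul_assoc, ← mul_assoc, ← Complex.ofReal_mul,
      mul_inv_cancel₀ (by positivity), Complex.ofReal_one, one_mul]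
  simp only [hmean, integral_const_mul] at hswap
  rw [integral_const] at hswap
  have hvol : (volume.restrict (Set.Ioc 0 (2 * Real.pi))).real Set.univ = 2 * Real.pi := by
    simp [Real.pi_pos.le]
  rw [hvol, Complex.real_smul] at hswap
  exact mul_left_cancel₀ (by exact_mod_cast (by positivity : (2 * Real.pi : ℝ) ≠ 0)) hswap

/-- In polar coordinates the Jacobian r cancels the singularity 1/r. -/
theorem integrable_indicator_ball_inv_norm :
    Integrable (fun z : ℂ => (Metric.ball (0 : ℂ) 1).indicator (fun z => ‖z‖⁻¹) z) := by
  have h := (integrable_fun_norm_addHaar (volume : Measure ℂ)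
    (f := (Set.Iio (1 : ℝ)).indicator fun t => t⁻¹)).2 (by
      simp only [Complex.finrank_real_complex, Nat.add_one_sub_one, pow_one, smul_eq_mul]
      have : IntegrableOn ((Set.Iio (1 : ℝ)).indicator fun _ => (1 : ℝ)) (Set.Ioi 0) := by
        rw [IntegrableOn, integrable_indicator_iff measurableSet_Iio, IntegrableOn,
          Measure.restrict_restrict measurableSet_Iio, Set.inter_comm, Set.Ioi_inter_Iio]
        exact integrableOn_const (by simp)
      refine this.congr_fun (fun t ht => ?_) measurableSet_Ioi
      have ht' : t ≠ 0 := (Set.mem_Ioi.1 ht).ne'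
      by_cases h1 : t < 1 <;> simp [Set.indicator, h1, ht'])
  refine h.congr (Filter.Eventually.of_forall fun z => ?_)
  by_cases h1 : ‖z‖ < 1 <;> simp [Set.indicator, h1]

/-- The Cauchy transform of a bounded integrable function exists everywhere and is bounded. -/
theorem cauchyTransform_bounded {φ : ℂ → ℂ} (hφ : Integrable φ) {M : ℝ} (hM : ∀ z, ‖φ z‖ ≤ M) :
    (∀ w, Integrable fun z => φ z / (z - w)) ∧
      ∃ K, 0 ≤ K ∧ ∀ w, ‖∫ z, φ z / (z - w)‖ ≤ K := by
  set κ : ℂ → ℝ := fun z => (Metric.ball (0 : ℂ) 1).indicator (fun z => ‖z‖⁻¹) z with hκ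
  have hM0 : 0 ≤ M := (norm_nonneg _).trans (hM 0)
  have hκ0 : ∀ z, 0 ≤ κ z := fun z => Set.indicator_nonneg (fun _ _ => by positivity) z
  -- Near w the bound M leaves the integrable kernel 1/|z-w|; elsewhere the denominator is at least
  -- 1.
  have hb : ∀ w z, ‖φ z / (z - w)‖ ≤ M * κ (z - w) + ‖φ z‖ := fun w z => by
    rw [norm_div]
    by_cases h : ‖z - w‖ < 1
    · have : κ (z - w) = ‖z - w‖⁻¹ := by simp [hκ, h]
      rw [this, div_eq_mul_inv]
      have := mul_le_mul_of_nonneg_right (hM z) (inv_nonneg.2 (norm_nonneg (z - w)))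
      linarith [norm_nonneg (φ z)]
    · have h1 := div_le_self (norm_nonneg (φ z)) (not_lt.1 h)
      have := mul_nonneg hM0 (hκ0 (z - w))
      linarith
  have hbi : ∀ w, Integrable fun z => M * κ (z - w) + ‖φ z‖ := fun w =>
    ((integrable_indicator_ball_inv_norm.comp_sub_right w).const_mul M).add hφ.norm
  refine ⟨fun w => (hbi w).mono' ?_ (Filter.Eventually.of_forall (hb w)),
    M * (∫ z, κ z) + ∫ z, ‖φ z‖, ?_, fun w => ?_⟩
  · exact hφ.1.div₀ (by fun_prop : Measurable fun z : ℂ => z - w).aestronglyMeasurable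
  · have h1 : 0 ≤ ∫ z, κ z := integral_nonneg hκ0
    have h2 : 0 ≤ ∫ z, ‖φ z‖ := integral_nonneg fun z => norm_nonneg _
    positivity
  · refine (norm_integral_le_of_norm_le (hbi w) (Filter.Eventually.of_forall (hb w))).trans ?_
    rw [integral_add ((integrable_indicator_ball_inv_norm.comp_sub_right w).const_mul M) hφ.norm,
      integral_const_mul, integral_sub_right_eq_self κ w]

/-- The Cauchy transform of `φ` multiplied by the variable. -/
theorem mul_cauchyTransform {φ : ℂ → ℂ} (hφ : Integrable φ) (w : ℂ)
    (hw : Integrable fun z => φ z / (z - w)) :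
    w * ∫ z, φ z / (z - w) = (∫ z, z * φ z / (z - w)) - ∫ z, φ z := by
  have hae : ∀ᵐ z : ℂ, z ≠ w := by simp [ae_iff]
  have h : (fun z => z * φ z / (z - w)) =ᵐ[volume] fun z => φ z + w * (φ z / (z - w)) := by
    filter_upwards [hae] with z hz
    have : z - w ≠ 0 := sub_ne_zero.2 hz
    field_simp
    ring
  rw [integral_congr_ae h, integral_add hφ (hw.const_mul w), integral_const_mul]
  ring

/-- A locally dominated integral of entire functions of a parameter is an entire function of
the parameter. -/
theorem differentiable_integral_of_dominated {f : ℂ → ℂ → ℂ}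
    (hmeas : ∀ w, AEStronglyMeasurable (f w)) (hdiff : ∀ z, Differentiable ℂ fun w => f w z)
    (hbound : ∀ R : ℝ, ∃ B : ℂ → ℝ, Integrable B ∧ ∀ w, ‖w‖ ≤ R → ∀ z, ‖f w z‖ ≤ B z) :
    Differentiable ℂ fun w => ∫ z, f w z := by
  intro w₀
  -- One unit for the ball around w₀, one for the circles of Cauchy's estimate, so that B also
  -- dominates the derivatives.
  obtain ⟨B, hB, hle⟩ := hbound (‖w₀‖ + 2)
  refine (hasDerivAt_integral_of_dominated_loc_of_deriv_le (μ := volume)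
    (F' := fun w z => deriv (fun w => f w z) w) (bound := B) (Metric.ball_mem_nhds w₀ one_pos)
    (Filter.Eventually.of_forall hmeas) ?_ ?_ ?_ hB ?_).2.differentiableAt
  · exact hB.mono' (hmeas w₀) (Filter.Eventually.of_forall (hle w₀ (by linarith)))
  · have hu : Filter.Tendsto (fun n : ℕ => w₀ + ((n : ℂ) + 1)⁻¹) Filter.atTop
        (nhdsWithin w₀ {w₀}ᶜ) := by
      refine tendsto_nhdsWithin_iff.2 ⟨?_, Filter.Eventually.of_forall fun n => ?_⟩
      · have := (tendsto_one_div_add_atTop_nhds_zero_nat (𝕜 := ℂ)).const_add w₀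
        simpa using this
      · have : (n : ℂ) + 1 ≠ 0 := by exact_mod_cast n.succ_ne_zero
        simpa using this
    refine aestronglyMeasurable_of_tendsto_ae Filter.atTop
      (f := fun (n : ℕ) z => slope (fun w => f w z) w₀ (w₀ + ((n : ℂ) + 1)⁻¹)) (fun n => ?_) ?_
    · simp only [slope_def_module]
      exact ((hmeas _).sub (hmeas _)).const_smul (_ : ℂ)
    · exact Filter.Eventually.of_forall fun z =>
        (hasDerivAt_iff_tendsto_slope.1 (hdiff z w₀).hasDerivAt).comp hu
  · refine Filter.Eventually.of_forall fun z w hw => ?_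
    have := Complex.norm_deriv_le_of_forall_mem_sphere_norm_le (c := w) (C := B z) one_pos
      (hdiff z).diffContOnCl fun ζ hζ => hle ζ ?_ z
    · simpa using this
    · have h1 : ‖ζ - w‖ = 1 := by simpa [dist_eq_norm] using hζ
      have h2 : ‖w - w₀‖ < 1 := by simpa [dist_eq_norm] using hw
      calc ‖ζ‖ = ‖(ζ - w) + (w - w₀) + w₀‖ := by ring_nf
        _ ≤ ‖ζ - w‖ + ‖w - w₀‖ + ‖w₀‖ := norm_add₃_le
        _ ≤ _ := by linarith
  · exact Filter.Eventually.of_forall fun z w _ => (hdiff z w).hasDerivAt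

theorem Differentiable.dslope {f : ℂ → ℂ} (hf : Differentiable ℂ f) (w : ℂ) :
    Differentiable ℂ (dslope f w) :=
  differentiableOn_univ.1 ((Complex.differentiableOn_dslope Filter.univ_mem).2 hf.differentiableOn)

/-- An entire function that vanishes on the zeros of an entire function with simple zeros is
a multiple of it. -/
theorem exists_eq_mul_of_simple_zeros {F I : ℂ → ℂ} (hF : Differentiable ℂ F)
    (hI : Differentiable ℂ I) (hsimple : ∀ z, F z = 0 → deriv F z ≠ 0)
    (hzero : ∀ z, F z = 0 → I z = 0) :
    ∃ G : ℂ → ℂ, Differentiable ℂ G ∧ ∀ z, I z = F z * G z := by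
  classical
  -- At a common zero the quotient I/F equals the quotient of the two difference quotients, whose
  -- denominator tends to F' ≠ 0.
  refine ⟨fun z => if F z = 0 then deriv I z / deriv F z else I z / F z, fun w => ?_, fun z => ?_⟩
  · by_cases hw : F w = 0
    · have hne : dslope F w w ≠ 0 := by simpa using hsimple w hw
      have hdiv : DifferentiableAt ℂ (fun z => dslope I w z / dslope F w z) w :=
        (hI.dslope w w).div (hF.dslope w w) hne
      refine hdiv.congr_of_eventuallyEq ?_
      filter_upwards [(hF.dslope w).continuous.continuousAt.eventually_ne hne] with z hz
      by_cases hzw : z = w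
      · simp [hzw, hw]
      · have h0 : z - w ≠ 0 := sub_ne_zero.2 hzw
        rw [dslope_of_ne _ hzw, slope_def_field, hw, sub_zero] at hz
        have hFz : F z ≠ 0 := fun h => hz (by simp [h])
        rw [dslope_of_ne _ hzw, dslope_of_ne _ hzw, slope_def_field, slope_def_field, hw,
          hzero w hw, if_neg hFz]
        field_simp
        simp [mul_comm]
    · have hdiv : DifferentiableAt ℂ (fun z => I z / F z) w := (hI w).div (hF w) hw
      refine hdiv.congr_of_eventuallyEq ?_
      filter_upwards [hF.continuous.continuousAt.eventually_ne hw] with z hz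
      simp [hz]
  · by_cases hz : F z = 0
    · simp [hz, hzero z hz]
    · simp only [hz, if_false]
      field_simp

/-! ### Reproducing kernels and completeness of the Fock space -/

theorem integral_fockWeight_pos : 0 < ∫ z, fockWeight z := by
  refine (integral_pos_iff_support_of_nonneg (fun z => (fockWeight_pos z).le)
    integrable_fockWeight).2 ?_
  have : Function.support fockWeight = Set.univ := by
    ext z
    simpa using (fockWeight_pos z).ne'
  rw [this]
  simp

/-- The reproducing property of the kernels of the Fock space. -/
theorem inner_fockKernel (w : ℂ) (f : FockSpace) :
    inner ℂ (fockKernel w) f = (∫ z, fockWeight z : ℝ) * f w := by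
  set p : ℂ → ℂ := fun z =>
    (starRingEnd ℂ) (fockKernel w z) * f z * (Real.exp (-Real.pi * ‖z‖ ^ 2) : ℂ) with hp
  have hpi : Integrable p := FockSpace.integrable_inner _ _
  -- Translation by w completes the square: conj(k_w) times the weight at w + v is e^{-π \bar w v}
  -- e^{-π|v|²}, so the radial mean value property applies and g 0 = f w.
  set g : ℂ → ℂ := fun v => f (w + v) * Complex.exp (-Real.pi * (starRingEnd ℂ) w * v) with hgdef
  have hg : Differentiable ℂ g := by
    have := f.memFock.1
    exact (this.comp (by fun_prop : Differentiable ℂ fun v : ℂ => w + v)).mul (by fun_prop)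
  have hsq : ∀ z : ℂ, ((‖z‖ : ℂ)) ^ 2 = z * (starRingEnd ℂ) z := fun z => (Complex.mul_conj' z).symm
  have heq : ∀ v, g v * (Real.exp (-Real.pi * ‖v‖ ^ 2) : ℂ) = p (w + v) := fun v => by
    simp only [hgdef, hp, fockKernel, FockSpace.mk_apply]
    rw [← Complex.exp_conj, mul_comm _ (f (w + v)), mul_assoc (f (w + v)),
      mul_assoc (f (w + v))]
    congr 1
    push_cast
    rw [← Complex.exp_add, ← Complex.exp_add, hsq, hsq]
    congr 1
    simp only [map_mul, map_add, Complex.conj_conj, Complex.conj_ofReal]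
    ring
  have hφ : Continuous fun t : ℝ => Real.exp (-Real.pi * t ^ 2) := by fun_prop
  have key := integral_mul_radial hg hφ (by
    simp only [heq]
    exact hpi.comp_add_left w)
  simp only [heq, integral_add_left_eq_self p w] at key
  rw [FockSpace.inner_def, ← integral_complex_ofReal]
  refine key.trans ?_
  simp [hgdef, fockWeight, mul_comm]

theorem norm_fockKernel_sq (w : ℂ) :
    ‖fockKernel w‖ ^ 2 = (∫ z, fockWeight z) * Real.exp (Real.pi * ‖w‖ ^ 2) := by
  rw [← inner_self_eq_norm_sq (𝕜 := ℂ), inner_fockKernel]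
  have : fockKernel w w = (Real.exp (Real.pi * ‖w‖ ^ 2) : ℂ) := by
    simp only [fockKernel, FockSpace.mk_apply]
    push_cast
    rw [mul_assoc, Complex.conj_mul']
  rw [this, ← Complex.ofReal_mul]
  exact Complex.ofReal_re _

/-- Point evaluations are bounded on the Fock space. -/
theorem exists_norm_apply_le : ∃ C : ℝ, 0 ≤ C ∧ ∀ (f : FockSpace) (w : ℂ),
    ‖f w‖ ≤ C * ‖f‖ * Real.exp (Real.pi / 2 * ‖w‖ ^ 2) := by
  set c := ∫ z, fockWeight z with hc
  have hc0 : 0 < c := integral_fockWeight_pos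
  refine ⟨√c / c, by positivity, fun f w => ?_⟩
  have hk : ‖fockKernel w‖ = √c * Real.exp (Real.pi / 2 * ‖w‖ ^ 2) := by
    rw [← sq_eq_sq₀ (norm_nonneg _) (by positivity), norm_fockKernel_sq, mul_pow,
      Real.sq_sqrt hc0.le, ← Real.exp_nat_mul]
    congr 2
    push_cast
    ring
  have h := norm_inner_le_norm (𝕜 := ℂ) (fockKernel w) f
  rw [inner_fockKernel, norm_mul, Complex.norm_real, Real.norm_of_nonneg hc0.le, hk] at h
  rw [div_mul_eq_mul_div, div_mul_eq_mul_div, le_div_iff₀ hc0]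
  linarith

theorem FockSpace.norm_sq_eq (f : FockSpace) :
    ‖f‖ ^ 2 = ∫ z : ℂ, ‖f z‖ ^ 2 * Real.exp (-Real.pi * ‖z‖ ^ 2) := by
  rw [← inner_self_eq_norm_sq (𝕜 := ℂ), FockSpace.inner_self]
  exact Complex.ofReal_re _

theorem FockSpace.lintegral_eq (f : FockSpace) :
    ∫⁻ z : ℂ, ENNReal.ofReal (‖f z‖ ^ 2 * Real.exp (-Real.pi * ‖z‖ ^ 2)) =
      ENNReal.ofReal (‖f‖ ^ 2) := by
  rw [FockSpace.norm_sq_eq, ofReal_integral_eq_lintegral_ofReal f.memFock.2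
    (Filter.Eventually.of_forall fun z => by positivity)]

/-- Bounded point evaluations turn norm Cauchy sequences into locally uniformly convergent ones, so
the limit is entire, and Fatou's lemma gives norm convergence. Completeness is what lets density be
tested by orthogonality. -/
instance : CompleteSpace FockSpace := by
  obtain ⟨C, hC0, hC⟩ := exists_norm_apply_le
  refine Metric.complete_of_cauchySeq_tendsto fun u hu => ?_
  have hsub : ∀ m n z, u m z - u n z = (u m - u n) z := fun m n z => by
    rw [sub_eq_add_neg, sub_eq_add_neg, FockSpace.add_apply, ← neg_one_smul ℂ (u n),
      FockSpace.smul_apply]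
    ring
  have huc : ∀ R : ℝ, UniformCauchySeqOn (fun n => (u n : ℂ → ℂ)) Filter.atTop
      (Metric.closedBall 0 R) := fun R => by
    rw [Metric.uniformCauchySeqOn_iff]
    intro ε hε
    set B := C * Real.exp (Real.pi / 2 * R ^ 2) + 1 with hB
    have hB0 : 0 < B := by positivity
    obtain ⟨N, hN⟩ := Metric.cauchySeq_iff.1 hu (ε / B) (by positivity)
    refine ⟨N, fun m hm n hn z hz => ?_⟩
    have hz' : ‖z‖ ≤ R := by simpa using hz
    have h1 := hN m hm n hn
    rw [dist_eq_norm] at h1 ⊢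
    rw [hsub]
    calc ‖(u m - u n) z‖ ≤ C * ‖u m - u n‖ * Real.exp (Real.pi / 2 * ‖z‖ ^ 2) := hC _ _
      _ ≤ C * ‖u m - u n‖ * Real.exp (Real.pi / 2 * R ^ 2) := by gcongr
      _ = ‖u m - u n‖ * (C * Real.exp (Real.pi / 2 * R ^ 2)) := by ring
      _ ≤ ‖u m - u n‖ * B := by gcongr; linarith
      _ < ε := by rwa [lt_div_iff₀ hB0] at h1
  have hpt : ∀ z, ∃ l, Filter.Tendsto (fun n => u n z) Filter.atTop (nhds l) := fun z =>
    cauchySeq_tendsto_of_complete ((huc ‖z‖).cauchySeq (by simp))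
  choose f hf using hpt
  have hfd : Differentiable ℂ f := by
    have : TendstoLocallyUniformlyOn (fun n => (u n : ℂ → ℂ)) f Filter.atTop Set.univ := by
      rw [tendstoLocallyUniformlyOn_iff_forall_isCompact isOpen_univ]
      intro K _ hK
      obtain ⟨R, hR⟩ := hK.isBounded.subset_closedBall 0
      exact ((huc R).tendstoUniformlyOn_of_tendsto fun z _ => hf z).mono hR
    exact differentiableOn_univ.1 (this.differentiableOn
      (Filter.Eventually.of_forall fun n => (u n).memFock.1.differentiableOn) isOpen_univ)
  have hfatou : ∀ (n : ℕ) (ε : ℝ), (∀ m ≥ n, ‖u m - u n‖ ≤ ε) →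
      ∫⁻ z : ℂ, ENNReal.ofReal (‖f z - u n z‖ ^ 2 * Real.exp (-Real.pi * ‖z‖ ^ 2)) ≤
        ENNReal.ofReal (ε ^ 2) := fun n ε hε => by
    have hlim : ∀ z : ℂ, Filter.Tendsto (fun m => ENNReal.ofReal
        (‖(u m - u n) z‖ ^ 2 * Real.exp (-Real.pi * ‖z‖ ^ 2))) Filter.atTop
        (nhds (ENNReal.ofReal (‖f z - u n z‖ ^ 2 * Real.exp (-Real.pi * ‖z‖ ^ 2)))) := fun z => by
      simp only [← hsub]
      exact ENNReal.tendsto_ofReal (((((hf z).sub_const _).norm).pow 2).mul_const _)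
    calc ∫⁻ z : ℂ, ENNReal.ofReal (‖f z - u n z‖ ^ 2 * Real.exp (-Real.pi * ‖z‖ ^ 2))
        = ∫⁻ z : ℂ, Filter.liminf (fun m => ENNReal.ofReal
            (‖(u m - u n) z‖ ^ 2 * Real.exp (-Real.pi * ‖z‖ ^ 2))) Filter.atTop :=
          lintegral_congr fun z => (hlim z).liminf_eq.symm
      _ ≤ Filter.liminf (fun m => ∫⁻ z : ℂ, ENNReal.ofReal
            (‖(u m - u n) z‖ ^ 2 * Real.exp (-Real.pi * ‖z‖ ^ 2))) Filter.atTop :=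
          lintegral_liminf_le fun m => by
            have := (u m - u n).memFock.1.continuous
            fun_prop
      _ ≤ ENNReal.ofReal (ε ^ 2) := by
          refine Filter.liminf_le_of_frequently_le' (Filter.Eventually.frequently ?_)
          filter_upwards [Filter.eventually_ge_atTop n] with m hm
          rw [FockSpace.lintegral_eq]
          have := hε m hm
          gcongr
  have hmemsub : ∀ (n : ℕ) (ε : ℝ), (∀ m ≥ n, ‖u m - u n‖ ≤ ε) →
      MemFock (fun z => f z - u n z) := fun n ε hε => by
    have hd : Differentiable ℂ fun z => f z - u n z := hfd.sub (u n).memFock.1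
    refine ⟨hd, ?_, ?_⟩
    · have := hd.continuous
      exact Continuous.aestronglyMeasurable (by fun_prop)
    · rw [hasFiniteIntegral_iff_ofReal (Filter.Eventually.of_forall fun z => by positivity)]
      exact (hfatou n ε hε).trans_lt ENNReal.ofReal_lt_top
  have hcau : ∀ ε > 0, ∃ N, ∀ n ≥ N, ∀ m ≥ n, ‖u m - u n‖ ≤ ε := fun ε hε => by
    obtain ⟨N, hN⟩ := Metric.cauchySeq_iff.1 hu ε hε
    refine ⟨N, fun n hn m hm => ?_⟩
    rw [← dist_eq_norm]
    exact (hN m (hn.trans hm) n hn).le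
  have hmem : MemFock f := by
    obtain ⟨N, hN⟩ := hcau 1 one_pos
    have h := (hmemsub N 1 (hN N le_rfl)).add (u N).memFock
    have heq : (fun z => f z - u N z) + (u N : ℂ → ℂ) = f := by
      ext z
      simp
    rwa [heq] at h
  refine ⟨FockSpace.mk f hmem, Metric.tendsto_atTop.2 fun ε hε => ?_⟩
  obtain ⟨N, hN⟩ := hcau (ε / 2) (half_pos hε)
  refine ⟨N, fun n hn => ?_⟩
  have h1 : FockSpace.mk f hmem - u n = FockSpace.mk _ (hmemsub n _ (hN n hn)) := by
    refine FockSpace.ext fun z => ?_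
    rw [sub_eq_add_neg, FockSpace.add_apply, ← neg_one_smul ℂ (u n), FockSpace.smul_apply]
    simp [sub_eq_add_neg]
  rw [dist_comm, dist_eq_norm, h1]
  have h2 := hfatou n _ (hN n hn)
  have h3 := FockSpace.lintegral_eq (FockSpace.mk _ (hmemsub n _ (hN n hn)))
  simp only [FockSpace.mk_apply] at h3
  rw [h3, ENNReal.ofReal_le_ofReal_iff (by positivity)] at h2
  have h4 := abs_le_of_sq_le_sq h2 (by positivity)
  rw [abs_norm] at h4
  linarith

/-! ### Growth criterion, dual density and moments -/

/-- An entire function that is dominated near infinity by a power and an element of the Fock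
space is in the Fock space. -/
theorem MemFock.of_growth {f g : ℂ → ℂ} (hf : Differentiable ℂ f) (hg : MemFock g) {A B R : ℝ}
    (n : ℕ) (h : ∀ z, R ≤ ‖z‖ → ‖f z‖ ≤ A * (1 + ‖z‖) ^ n + B * ‖g z‖) : MemFock f := by
  obtain ⟨M, hM⟩ := (isCompact_closedBall (0 : ℂ) R).exists_bound_of_continuousOn
    hf.continuous.continuousOn
  have hbd : ∀ z, ‖f z‖ ≤ (|A| + |M|) * (1 + ‖z‖) ^ n + |B| * ‖g z‖ := fun z => by
    have h1 : 1 ≤ (1 + ‖z‖) ^ n := one_le_pow₀ (by linarith [norm_nonneg z])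
    have h2 : 0 ≤ |A| * (1 + ‖z‖) ^ n := by positivity
    have h3 : 0 ≤ |B| * ‖g z‖ := by positivity
    rcases le_total R ‖z‖ with hz | hz
    · have h4 : A * (1 + ‖z‖) ^ n ≤ |A| * (1 + ‖z‖) ^ n := by gcongr; exact le_abs_self A
      have h5 : B * ‖g z‖ ≤ |B| * ‖g z‖ := by gcongr; exact le_abs_self B
      have h6 : 0 ≤ |M| * (1 + ‖z‖) ^ n := by positivity
      linarith [h z hz]
    · have h4 := (hM z (by simpa using hz)).trans (le_abs_self M)
      have h5 := mul_le_mul_of_nonneg_left h1 (abs_nonneg M)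
      linarith
  set D := |A| + |M| with hD
  refine ⟨hf, ((((integrable_one_add_norm_pow_mul_exp_neg (2 * n) Real.pi_pos).const_mul
    (2 * D ^ 2))).add (hg.2.const_mul (2 * |B| ^ 2))).mono' ?_ ?_⟩
  · have := hf.continuous
    exact Continuous.aestronglyMeasurable (by fun_prop)
  · refine Filter.Eventually.of_forall fun z => ?_
    rw [Real.norm_of_nonneg (by positivity)]
    have h1 : ‖f z‖ ^ 2 ≤ 2 * D ^ 2 * (1 + ‖z‖) ^ (2 * n) + 2 * |B| ^ 2 * ‖g z‖ ^ 2 := by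
      calc ‖f z‖ ^ 2 ≤ (D * (1 + ‖z‖) ^ n + |B| * ‖g z‖) ^ 2 := by gcongr; exact hbd z
        _ ≤ 2 * ((D * (1 + ‖z‖) ^ n) ^ 2 + (|B| * ‖g z‖) ^ 2) := add_sq_le
        _ = _ := by ring
    have := mul_le_mul_of_nonneg_right h1 (Real.exp_pos (-Real.pi * ‖z‖ ^ 2)).le
    simp only [Pi.add_apply]
    linarith

/-- The density `conj (h z) e^{-π|z|²}`, against which the inner product with `h` integrates. -/
def FockSpace.dual (h : FockSpace) (z : ℂ) : ℂ := (starRingEnd ℂ) (h z) * fockWeight z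

theorem FockSpace.continuous_dual (h : FockSpace) : Continuous h.dual := by
  have := h.memFock.1.continuous
  unfold FockSpace.dual
  fun_prop

theorem FockSpace.inner_eq_integral_dual (h f : FockSpace) :
    inner ℂ h f = ∫ z, f z * h.dual z := by
  rw [FockSpace.inner_def]
  refine integral_congr_ae (Filter.Eventually.of_forall fun z => ?_)
  simp only [FockSpace.dual, fockWeight]
  ring

theorem FockSpace.integrable_mul_dual (h f : FockSpace) : Integrable fun z => f z * h.dual z := by
  refine (FockSpace.integrable_inner h f).congr (Filter.Eventually.of_forall fun z => ?_)
  simp only [FockSpace.dual, fockWeight]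
  ring

theorem FockSpace.exists_norm_dual_le (h : FockSpace) : ∃ C, 0 ≤ C ∧
    ∀ z, ‖h.dual z‖ ≤ C * Real.exp (-(Real.pi / 2) * ‖z‖ ^ 2) := by
  obtain ⟨C, hC0, hC⟩ := exists_norm_apply_le
  refine ⟨C * ‖h‖, by positivity, fun z => ?_⟩
  rw [FockSpace.dual, norm_mul, RCLike.norm_conj, Complex.norm_real,
    Real.norm_of_nonneg (fockWeight_pos z).le, fockWeight]
  calc ‖h z‖ * Real.exp (-Real.pi * ‖z‖ ^ 2)
      ≤ C * ‖h‖ * Real.exp (Real.pi / 2 * ‖z‖ ^ 2) * Real.exp (-Real.pi * ‖z‖ ^ 2) := by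
        gcongr
        exact hC h z
    _ = _ := by
        rw [mul_assoc, ← Real.exp_add]
        congr 2
        ring

/-- The growth e^{π|z|²/2} of f is exactly cancelled by the decay of the dual density. The bound is
what the Cauchy transform of the product requires. -/
theorem FockSpace.exists_norm_mul_dual_le (h f : FockSpace) : ∃ M, ∀ z, ‖f z * h.dual z‖ ≤ M := by
  obtain ⟨C, hC0, hC⟩ := exists_norm_apply_le
  obtain ⟨D, hD0, hD⟩ := h.exists_norm_dual_le
  refine ⟨C * ‖f‖ * D, fun z => ?_⟩
  rw [norm_mul]
  calc ‖f z‖ * ‖h.dual z‖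
      ≤ C * ‖f‖ * Real.exp (Real.pi / 2 * ‖z‖ ^ 2) *
          (D * Real.exp (-(Real.pi / 2) * ‖z‖ ^ 2)) := by
        gcongr
        exacts [hC f z, hD z]
    _ = C * ‖f‖ * D * Real.exp (Real.pi / 2 * ‖z‖ ^ 2 + -(Real.pi / 2) * ‖z‖ ^ 2) := by
        rw [Real.exp_add]
        ring
    _ = C * ‖f‖ * D := by
        rw [← add_mul, add_neg_cancel, zero_mul, Real.exp_zero, mul_one]

theorem FockSpace.integrable_pow_mul_dual (h : FockSpace) (j : ℕ) :
    Integrable fun z => z ^ j * h.dual z := by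
  obtain ⟨D, hD0, hD⟩ := h.exists_norm_dual_le
  refine ((integrable_one_add_norm_pow_mul_exp_neg j Real.pi_div_two_pos).const_mul D).mono' ?_ ?_
  · have := h.continuous_dual
    exact Continuous.aestronglyMeasurable (by fun_prop)
  · refine Filter.Eventually.of_forall fun z => ?_
    rw [norm_mul, norm_pow]
    calc ‖z‖ ^ j * ‖h.dual z‖
        ≤ (1 + ‖z‖) ^ j * (D * Real.exp (-(Real.pi / 2) * ‖z‖ ^ 2)) := by
          gcongr
          exacts [by linarith, hD z]
      _ = _ := by ring

theorem FockSpace.exists_norm_pow_mul_dual_le (h : FockSpace) (j : ℕ) :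
    ∃ M, ∀ z, ‖z ^ j * h.dual z‖ ≤ M := by
  obtain ⟨D, hD0, hD⟩ := h.exists_norm_dual_le
  obtain ⟨K, hK0, hK⟩ := one_add_pow_mul_exp_neg_le j Real.pi_div_two_pos
  refine ⟨D * K, fun z => ?_⟩
  rw [norm_mul, norm_pow]
  calc ‖z‖ ^ j * ‖h.dual z‖
      ≤ (1 + ‖z‖) ^ j * (D * Real.exp (-(Real.pi / 2) * ‖z‖ ^ 2)) := by
        gcongr
        exacts [by linarith, hD z]
    _ = D * ((1 + ‖z‖) ^ j * Real.exp (-(Real.pi / 2) * ‖z‖ ^ 2)) := by ring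
    _ ≤ D * (K * Real.exp (-(Real.pi / 2 / 2) * ‖z‖ ^ 2)) :=
        mul_le_mul_of_nonneg_left (hK _ (norm_nonneg z)) hD0
    _ ≤ D * (K * 1) := by
        gcongr
        rw [Real.exp_le_one_iff]
        nlinarith [Real.pi_pos, sq_nonneg ‖z‖]
    _ = D * K := by ring

/-- A function in the Fock space that is orthogonal to all monomials is zero. -/
theorem FockSpace.eq_zero_of_moments_eq_zero (h : FockSpace)
    (hm : ∀ k : ℕ, ∫ z, z ^ k * h.dual z = 0) : h = 0 := by
  refine FockSpace.ext fun w => ?_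
  obtain ⟨D, hD0, hD⟩ := h.exists_norm_dual_le
  have hcont := h.continuous_dual
  set a : ℂ := Real.pi * (starRingEnd ℂ) w with ha
  -- Expanding the kernel at w in powers of z expresses its pairing with h through the moments; the
  -- majorant e^{|a||z|} is beaten by the Gaussian decay.
  have hsum : HasSum (fun n : ℕ => ∫ z, (a * z) ^ n / n.factorial * h.dual z)
      (∫ z, Complex.exp (a * z) * h.dual z) := by
    refine hasSum_integral_of_dominated_convergence
      (fun n z => (‖a‖ * ‖z‖) ^ n / n.factorial * ‖h.dual z‖) (fun n => ?_) (fun n => ?_) ?_ ?_ ?_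
    · exact Continuous.aestronglyMeasurable (by fun_prop)
    · refine Filter.Eventually.of_forall fun z => ?_
      simp [mul_pow]
    · exact Filter.Eventually.of_forall fun z =>
        (Real.summable_pow_div_factorial _).mul_right _
    · have heq : (fun z : ℂ => ∑' n : ℕ, (‖a‖ * ‖z‖) ^ n / n.factorial * ‖h.dual z‖) =
          fun z => Real.exp (‖a‖ * ‖z‖) * ‖h.dual z‖ := by
        ext z
        rw [tsum_mul_right, Real.exp_eq_exp_ℝ, NormedSpace.exp_eq_tsum_div]
      rw [heq]
      refine ((integrable_exp_neg_mul_norm_sq (b := Real.pi / 4) (by positivity)).const_mul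
        (D * Real.exp (‖a‖ ^ 2 / Real.pi))).mono' ?_ ?_
      · exact Continuous.aestronglyMeasurable (by fun_prop)
      · refine Filter.Eventually.of_forall fun z => ?_
        rw [Real.norm_of_nonneg (by positivity)]
        calc Real.exp (‖a‖ * ‖z‖) * ‖h.dual z‖
            ≤ Real.exp (‖a‖ * ‖z‖) * (D * Real.exp (-(Real.pi / 2) * ‖z‖ ^ 2)) := by
              gcongr
              exact hD z
          _ = D * Real.exp (‖a‖ * ‖z‖ + -(Real.pi / 2) * ‖z‖ ^ 2) := by
              rw [Real.exp_add]
              ring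
          _ ≤ D * Real.exp (‖a‖ ^ 2 / Real.pi + -(Real.pi / 4) * ‖z‖ ^ 2) := by
              refine mul_le_mul_of_nonneg_left (Real.exp_le_exp.2 ?_) hD0
              have h1 : 0 ≤ (2 * ‖a‖ - Real.pi * ‖z‖) ^ 2 / (4 * Real.pi) := by positivity
              have h2 : (2 * ‖a‖ - Real.pi * ‖z‖) ^ 2 / (4 * Real.pi) =
                  ‖a‖ ^ 2 / Real.pi - ‖a‖ * ‖z‖ + Real.pi / 4 * ‖z‖ ^ 2 := by
                field_simp
                ring
              linarith
          _ = _ := by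
              rw [Real.exp_add]
              ring
    · refine Filter.Eventually.of_forall fun z => HasSum.mul_right _ ?_
      rw [Complex.exp_eq_exp_ℂ]
      exact NormedSpace.expSeries_div_hasSum_exp _
  have hterm : ∀ n : ℕ, ∫ z, (a * z) ^ n / n.factorial * h.dual z = 0 := fun n => by
    have : ∀ z, (a * z) ^ n / n.factorial * h.dual z =
        a ^ n / n.factorial * (z ^ n * h.dual z) := fun z => by
      rw [mul_pow]
      ring
    simp only [this, integral_const_mul, hm, mul_zero]
  simp only [hterm] at hsum
  have h0 : inner ℂ h (fockKernel w) = 0 := by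
    rw [FockSpace.inner_eq_integral_dual]
    exact hsum.unique hasSum_zero
  rw [← inner_conj_symm, inner_fockKernel, map_eq_zero, mul_eq_zero, Complex.ofReal_eq_zero] at h0
  simpa using h0.resolve_left integral_fockWeight_pos.ne'

/-! ### Difference quotients -/

/-- Transfers holomorphy in the variable to holomorphy in the base point. -/
theorem dslope_symm (f : ℂ → ℂ) (w z : ℂ) : dslope f w z = dslope f z w := by
  by_cases h : z = w
  · rw [h]
  · rw [dslope_of_ne _ h, dslope_of_ne _ (Ne.symm h), slope_comm]

/-- Gives a majorant uniform in the base point over a disc: the mean value inequality for |z-w| < 1,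
and a denominator of size at least 1 otherwise. -/
theorem exists_norm_dslope_le {f : ℂ → ℂ} (hf : Differentiable ℂ f) (R : ℝ) :
    ∃ M, ∀ w, ‖w‖ ≤ R → ∀ z, ‖dslope f w z‖ ≤ ‖f z‖ + M := by
  obtain ⟨M₁, hM₁⟩ := (isCompact_closedBall (0 : ℂ) R).exists_bound_of_continuousOn
    hf.continuous.continuousOn
  obtain ⟨M₂, hM₂⟩ := (isCompact_closedBall (0 : ℂ) (R + 1)).exists_bound_of_continuousOn
    hf.contDiff.continuous_deriv_one.continuousOn
  refine ⟨|M₁| + |M₂|, fun w hw z => ?_⟩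
  have hw1 := hM₁ w (by simpa using hw)
  have hw2 := hM₂ w (by simpa using hw.trans (by linarith))
  have := le_abs_self M₁
  have := le_abs_self M₂
  have := norm_nonneg (f z)
  have := norm_nonneg (f w)
  have := abs_nonneg M₂
  by_cases h : z = w
  · rw [h, dslope_same]
    linarith
  rw [dslope_of_ne _ h, slope_def_field, norm_div]
  by_cases h1 : ‖z - w‖ < 1
  · have hpos : 0 < ‖z - w‖ := norm_pos_iff.2 (sub_ne_zero.2 h)
    have hz : ‖z‖ ≤ R + 1 := by
      calc ‖z‖ = ‖(z - w) + w‖ := by ring_nf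
        _ ≤ ‖z - w‖ + ‖w‖ := norm_add_le _ _
        _ ≤ _ := by linarith
    have := (convex_closedBall (0 : ℂ) (R + 1)).norm_image_sub_le_of_norm_deriv_le
      (fun x _ => hf x) hM₂ (x := w) (y := z) (by simpa using hw.trans (by linarith))
      (by simpa using hz)
    rw [div_le_iff₀ hpos]
    have h2 : M₂ * ‖z - w‖ ≤ (‖f z‖ + (|M₁| + |M₂|)) * ‖z - w‖ := by
      gcongr
      linarith
    linarith
  · have h2 := div_le_self (norm_nonneg (f z - f w)) (not_lt.1 h1)
    have h3 := norm_sub_le (f z) (f w)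
    linarith

/-! ### Asymptotics of Cauchy transforms -/

/-- The Cauchy transform of `z ^ j * conj (h z) e^{-π|z|²}`. -/
def FockSpace.cauchyMoment (h : FockSpace) (j : ℕ) (w : ℂ) : ℂ :=
  ∫ z, z ^ j * h.dual z / (z - w)

theorem FockSpace.exists_norm_cauchyMoment_le (h : FockSpace) (j : ℕ) :
    ∃ K, 0 ≤ K ∧ ∀ w, ‖h.cauchyMoment j w‖ ≤ K := by
  obtain ⟨M, hM⟩ := h.exists_norm_pow_mul_dual_le j
  exact (cauchyTransform_bounded (h.integrable_pow_mul_dual j) hM).2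

theorem FockSpace.mul_cauchyMoment (h : FockSpace) (j : ℕ) (w : ℂ) :
    w * h.cauchyMoment j w = h.cauchyMoment (j + 1) w - ∫ z, z ^ j * h.dual z := by
  obtain ⟨M, hM⟩ := h.exists_norm_pow_mul_dual_le j
  have hi := h.integrable_pow_mul_dual j
  rw [FockSpace.cauchyMoment, mul_cauchyTransform hi w ((cauchyTransform_bounded hi hM).1 w),
    FockSpace.cauchyMoment]
  simp only [pow_succ', mul_assoc]

/-- The Cauchy transform of the density of a nonzero function decays like a power. -/
theorem FockSpace.exists_le_norm_cauchyMoment {h : FockSpace} (hne : h ≠ 0) :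
    ∃ (n : ℕ) (c R : ℝ), 0 < c ∧ ∀ w, R ≤ ‖w‖ → c ≤ ‖w‖ ^ n * ‖h.cauchyMoment 0 w‖ := by
  classical
  have hex : ∃ k : ℕ, ∫ z, z ^ k * h.dual z ≠ 0 := by
    by_contra! hall
    exact hne (h.eq_zero_of_moments_eq_zero hall)
  set k := Nat.find hex with hk
  set m := ∫ z, z ^ k * h.dual z with hm
  have hm0 : 0 < ‖m‖ := norm_pos_iff.2 (Nat.find_spec hex)
  have hlt : ∀ j < k, ∫ z, z ^ j * h.dual z = 0 := fun j hj => not_not.1 (Nat.find_min hex hj)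
  -- As long as the moments vanish, multiplication by w just raises the index of the transform; at
  -- index k it releases the nonzero moment m.
  have hpow : ∀ w, ∀ j ≤ k, w ^ j * h.cauchyMoment 0 w = h.cauchyMoment j w := fun w j => by
    induction j with
    | zero => simp
    | succ j ih =>
      intro hj
      rw [pow_succ', mul_assoc, ih (by omega), h.mul_cauchyMoment, hlt j (by omega), sub_zero]
  obtain ⟨K, hK0, hK⟩ := h.exists_norm_cauchyMoment_le (k + 2)
  set m' := ∫ z, z ^ (k + 1) * h.dual z with hm'
  -- For such w the transform of index k + 1, which is O(1/|w|), is at most half of ‖m‖.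
  refine ⟨k + 1, ‖m‖ / 2, 2 * (K + ‖m'‖) / ‖m‖ + 1, half_pos hm0, fun w hw => ?_⟩
  have hw0 : 0 < ‖w‖ := lt_of_lt_of_le (by positivity) hw
  have h1 : w ^ (k + 1) * h.cauchyMoment 0 w = h.cauchyMoment (k + 1) w - m := by
    rw [pow_succ', mul_assoc, hpow w k le_rfl, h.mul_cauchyMoment]
  have h2 : ‖w‖ * ‖h.cauchyMoment (k + 1) w‖ ≤ K + ‖m'‖ := by
    rw [← norm_mul, h.mul_cauchyMoment]
    exact (norm_sub_le _ _).trans (by linarith [hK w])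
  have h3 : ‖h.cauchyMoment (k + 1) w‖ ≤ ‖m‖ / 2 := by
    have h4 : 2 * (K + ‖m'‖) ≤ ‖w‖ * ‖m‖ := by
      rw [← div_le_iff₀ hm0]
      linarith
    refine le_of_mul_le_mul_left ?_ hw0
    linarith
  rw [← norm_pow, ← norm_mul, h1]
  have h5 := norm_sub_norm_le m (h.cauchyMoment (k + 1) w)
  rw [norm_sub_rev] at h5
  linarith

/-! ### Quotients of F by its linear factors -/

theorem divLinear_eq_dslope {F : ℂ → ℂ} {a : ℂ} (ha : F a = 0) : divLinear F a = dslope F a := by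
  ext z
  by_cases h : z = a
  · simp [divLinear, h]
  · rw [dslope_of_ne _ h, slope_def_field, ha, sub_zero, divLinear, Function.update_of_ne h]

theorem sub_mul_dslope {F : ℂ → ℂ} {a : ℂ} (ha : F a = 0) (z : ℂ) :
    (z - a) * dslope F a z = F z := by
  simpa [ha] using sub_smul_dslope F a z

theorem norm_sub_le_mul_one_add (w a : ℂ) : ‖w - a‖ ≤ (1 + ‖a‖) * (1 + ‖w‖) := by
  have h1 := norm_sub_le w a
  have h2 := mul_nonneg (norm_nonneg a) (norm_nonneg w)
  linarith

/-- Dividing by one zero or by another does not affect membership in the Fock space. -/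
theorem MemFock.dslope_of_dslope {F : ℂ → ℂ} (hF : Differentiable ℂ F) {a b : ℂ} (ha : F a = 0)
    (hb : F b = 0) (h : MemFock (dslope F a)) : MemFock (dslope F b) := by
  refine MemFock.of_growth (hF.dslope b) h (A := 0) (B := 1 + ‖b - a‖) (R := ‖b‖ + 1) 0
    fun z hz => ?_
  have h1 : 1 ≤ ‖z - b‖ := by
    have := norm_sub_norm_le z b
    linarith
  have h2 : ‖z - a‖ ≤ (1 + ‖b - a‖) * ‖z - b‖ := by
    have h3 : ‖z - a‖ ≤ ‖z - b‖ + ‖b - a‖ := by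
      simpa using norm_add_le (z - b) (b - a)
    have := mul_le_mul_of_nonneg_left h1 (norm_nonneg (b - a))
    linarith
  have h4 : ‖z - b‖ * ‖dslope F b z‖ = ‖z - a‖ * ‖dslope F a z‖ := by
    rw [← norm_mul, ← norm_mul, sub_mul_dslope ha, sub_mul_dslope hb]
  refine le_of_mul_le_mul_left ?_ (zero_lt_one.trans_le h1)
  rw [h4, zero_mul, zero_add]
  calc ‖z - a‖ * ‖dslope F a z‖ ≤ (1 + ‖b - a‖) * ‖z - b‖ * ‖dslope F a z‖ := by gcongr
    _ = _ := by ring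

/-- Both halves of the difference quotient converge separately. The left side is entire in w, while
the right side shows its growth. -/
theorem FockSpace.integral_dslope_mul_dual (h H : FockSpace) (w : ℂ) :
    ∫ z, dslope H w z * h.dual z =
      (∫ z, H z * h.dual z / (z - w)) - H w * h.cauchyMoment 0 w := by
  obtain ⟨M, hM⟩ := h.exists_norm_mul_dual_le H
  obtain ⟨M₀, hM₀⟩ := h.exists_norm_pow_mul_dual_le 0
  have h1 := (cauchyTransform_bounded (h.integrable_mul_dual H) hM).1 w
  have h2 := (cauchyTransform_bounded (h.integrable_pow_mul_dual 0) hM₀).1 w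
  rw [FockSpace.cauchyMoment, ← integral_const_mul, ← integral_sub h1 (h2.const_mul _)]
  have hae : ∀ᵐ z : ℂ, z ≠ w := by simp [ae_iff]
  refine integral_congr_ae ?_
  filter_upwards [hae] with z hz
  rw [dslope_of_ne _ hz, slope_def_field]
  ring

theorem FockSpace.aestronglyMeasurable_dslope_mul_dual (h H : FockSpace) (w : ℂ) :
    AEStronglyMeasurable fun z => dslope H w z * h.dual z := by
  have := h.continuous_dual
  have := (H.memFock.1.dslope w).continuous
  exact Continuous.aestronglyMeasurable (by fun_prop)

theorem FockSpace.exists_integrable_bound_dslope_mul_dual (h H : FockSpace) (R : ℝ) :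
    ∃ B : ℂ → ℝ, Integrable B ∧ ∀ w, ‖w‖ ≤ R → ∀ z, ‖dslope H w z * h.dual z‖ ≤ B z := by
  obtain ⟨M, hM⟩ := exists_norm_dslope_le H.memFock.1 R
  have h0 := (h.integrable_pow_mul_dual 0).norm.const_mul M
  simp only [pow_zero, one_mul] at h0
  refine ⟨_, (h.integrable_mul_dual H).norm.add h0, fun w hw z => ?_⟩
  rw [Pi.add_apply, norm_mul, norm_mul, ← add_mul]
  gcongr
  exact hM w hw z

theorem FockSpace.integrable_dslope_mul_dual (h H : FockSpace) (w : ℂ) :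
    Integrable fun z => dslope H w z * h.dual z := by
  obtain ⟨B, hB, hle⟩ := h.exists_integrable_bound_dslope_mul_dual H ‖w‖
  exact hB.mono' (h.aestronglyMeasurable_dslope_mul_dual H w)
    (Filter.Eventually.of_forall (hle w le_rfl))

theorem FockSpace.differentiable_integral_dslope_mul_dual (h H : FockSpace) :
    Differentiable ℂ fun w => ∫ z, dslope H w z * h.dual z := by
  refine differentiable_integral_of_dominated (h.aestronglyMeasurable_dslope_mul_dual H)
    (fun z => ?_) (h.exists_integrable_bound_dslope_mul_dual H)
  simp only [dslope_symm _ _ z]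
  exact (H.memFock.1.dslope z).mul_const _

/-! ### The orthogonality argument -/

/-- A function in the Fock space that is orthogonal to all quotients of a generating function by
its linear factors is zero. -/
theorem IsGeneratingFunction.eq_zero_of_orthogonal {Λ : Set ℂ} {F : ℂ → ℂ}
    (hF : IsGeneratingFunction Λ F) (h : FockSpace)
    (horth : ∀ b ∈ Λ, ∫ z, dslope F b z * h.dual z = 0) : h = 0 := by
  by_contra hne
  obtain ⟨a, haΛ, hamem⟩ := hF.div_mem
  have ha : F a = 0 := (hF.zeros a).2 haΛ
  rw [divLinear_eq_dslope ha] at hamem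
  set H := FockSpace.mk (dslope F a) hamem with hH
  have hFH : ∀ z, (z - a) * H z = F z := sub_mul_dslope ha
  set J : ℂ → ℂ := fun w => ∫ z, dslope H w z * h.dual z with hJ
  have hJd : Differentiable ℂ J := h.differentiable_integral_dslope_mul_dual H
  have hId : Differentiable ℂ fun w => (w - a) * J w := by fun_prop
  have hIzero : ∀ b, F b = 0 → (b - a) * J b = 0 := fun b hb => by
    have hae : ∀ᵐ z : ℂ, z ≠ b := by simp [ae_iff]
    have h1 := horth b ((hF.zeros b).1 hb)
    -- F/(z-b) = H + (b-a) H/(z-b), and H(b) may be subtracted from the last numerator since (b-a)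
    -- H(b) = F(b) = 0.
    have h2 : (fun z => dslope F b z * h.dual z) =ᵐ[volume]
        fun z => H z * h.dual z + (b - a) * (dslope H b z * h.dual z) := by
      filter_upwards [hae] with z hz
      have hz' : z - b ≠ 0 := sub_ne_zero.2 hz
      rw [dslope_of_ne _ hz, dslope_of_ne _ hz, slope_def_field, slope_def_field, hb, ← hFH z]
      have h3 : (b - a) * H b = 0 := (hFH b).trans hb
      field_simp
      linear_combination h.dual z * h3
    have h4 : ∫ z, H z * h.dual z = 0 := horth a haΛ
    rwa [integral_congr_ae h2, integral_add (h.integrable_mul_dual H)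
      ((h.integrable_dslope_mul_dual H b).const_mul _),
      integral_const_mul, h4, zero_add] at h1
  obtain ⟨G, hGd, hG⟩ := exists_eq_mul_of_simple_zeros hF.entire hId
    (fun z hz => hF.simple z ((hF.zeros z).1 hz)) hIzero
  obtain ⟨M, hM⟩ := h.exists_norm_mul_dual_le H
  obtain ⟨K, hK0, hK⟩ := (cauchyTransform_bounded (h.integrable_mul_dual H) hM).2
  obtain ⟨K₀, hK₀0, hK₀⟩ := h.exists_norm_cauchyMoment_le 0
  obtain ⟨K₁, hK₁0, hK₁⟩ := h.exists_norm_cauchyMoment_le 1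
  set m := ∫ z, z ^ 0 * h.dual z with hm
  have hImem : MemFock fun w => F w * G w := by
    simp only [← hG]
    -- A comes from the bounded transform of H times the density, at the cost of one power for w -
    -- a. B bounds (w-a) times the transform of index 0, which is the transform of index 1, minus m,
    -- minus a times the transform of index 0.
    refine MemFock.of_growth hId H.memFock (A := (1 + ‖a‖) * K)
      (B := K₁ + ‖m‖ + ‖a‖ * K₀) (R := 0) 1 fun w _ => ?_
    have h1 : (w - a) * J w = (w - a) * (∫ z, H z * h.dual z / (z - w)) -
        H w * ((w - a) * h.cauchyMoment 0 w) := by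
      simp only [hJ]
      rw [h.integral_dslope_mul_dual H w]
      ring
    have h2 : ‖(w - a) * h.cauchyMoment 0 w‖ ≤ K₁ + ‖m‖ + ‖a‖ * K₀ := by
      rw [sub_mul, h.mul_cauchyMoment]
      refine (norm_sub_le _ _).trans (add_le_add ((norm_sub_le _ _).trans ?_) ?_)
      · gcongr
        exact hK₁ w
      · rw [norm_mul]
        gcongr
        exact hK₀ w
    rw [h1, pow_one]
    refine (norm_sub_le _ _).trans (add_le_add ?_ ?_)
    · rw [norm_mul]
      calc ‖w - a‖ * ‖∫ z, H z * h.dual z / (z - w)‖ ≤ (1 + ‖a‖) * (1 + ‖w‖) * K := by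
            gcongr
            exacts [norm_sub_le_mul_one_add w a, hK w]
        _ = _ := by ring
    · rw [norm_mul, mul_comm]
      gcongr
  have hG0 : G = 0 := by
    by_contra hG0
    exact hF.mul_not_mem G hGd hG0 hImem
  have hIeq : ∀ w, (w - a) * (∫ z, H z * h.dual z / (z - w)) = F w * h.cauchyMoment 0 w :=
    fun w => by
      have h1 := hG w
      simp only [hG0, Pi.zero_apply, mul_zero, hJ] at h1
      rw [h.integral_dslope_mul_dual H w] at h1
      rw [← hFH w]
      linear_combination h1
  obtain ⟨n, c, R, hc, hR⟩ := FockSpace.exists_le_norm_cauchyMoment hne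
  refine hF.mul_not_mem (fun _ => 1) (differentiable_const _) (fun h1 => ?_) ?_
  · exact one_ne_zero (congrFun h1 0)
  · simp only [mul_one]
    -- The bound is purely polynomial, so F is compared with 0; the degree is n from the lower bound
    -- plus one from w - a.
    refine MemFock.of_growth hF.entire memFock_zero (A := (1 + ‖a‖) * K / c) (B := 0) (R := R)
      (n + 1) fun w hw => ?_
    rw [zero_mul, add_zero, div_mul_eq_mul_div, le_div_iff₀ hc]
    calc ‖F w‖ * c ≤ ‖F w‖ * (‖w‖ ^ n * ‖h.cauchyMoment 0 w‖) := by
          gcongr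
          exact hR w hw
      _ = ‖w‖ ^ n * (‖w - a‖ * ‖∫ z, H z * h.dual z / (z - w)‖) := by
          rw [← norm_mul (w - a), hIeq, norm_mul]
          ring
      _ ≤ (1 + ‖w‖) ^ n * ((1 + ‖a‖) * (1 + ‖w‖) * K) := by
          gcongr
          exacts [by linarith, norm_sub_le_mul_one_add w a, hK w]
      _ = _ := by ring

end

theorem theorem2 (Λ : Set ℂ) (F : ℂ → ℂ)
    (hcomplete : IsCompleteSystem (fun a : Λ => fockKernel a))
    (hminimal : IsMinimalSystem (fun a : Λ => fockKernel a))
    (hF : IsGeneratingFunction Λ F) :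
    ∃ hmem : ∀ a : Λ, MemFock (divLinear F a),
      IsCompleteSystem (fun a : Λ => FockSpace.mk (divLinear F a) (hmem a)) := by
  have hmem : ∀ b : Λ, MemFock (divLinear F b) := fun b => by
    obtain ⟨a, haΛ, hamem⟩ := hF.div_mem
    have ha : F a = 0 := (hF.zeros a).2 haΛ
    have hb : F b = 0 := (hF.zeros b).2 b.2
    rw [divLinear_eq_dslope ha] at hamem
    rw [divLinear_eq_dslope hb]
    exact hamem.dslope_of_dslope hF.entire ha hb
  refine ⟨hmem, ?_⟩
  -- In a Hilbert space a span is dense exactly when its orthogonal complement is trivial.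
  rw [IsCompleteSystem, Submodule.topologicalClosure_eq_top_iff, Submodule.eq_bot_iff]
  intro h hh
  refine hF.eq_zero_of_orthogonal h fun b hb => ?_
  have h1 := Submodule.inner_left_of_mem_orthogonal
    (Submodule.subset_span (Set.mem_range_self (⟨b, hb⟩ : Λ))) hh
  rw [FockSpace.inner_eq_integral_dual] at h1
  simpa only [FockSpace.mk_apply, divLinear_eq_dslope ((hF.zeros b).2 hb)] using h1
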